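/- Let $P$ be a path (a finite path graph) whose vertex set is partitioned into $m$ nonempty classes $V_1,\ldots,V_m$. Then there exist two disjoint independent sets $S_1$ and $S_2$ of $P$ such that $S_1\cup S_2$ contains all vertices of $V_j$ except exactly one, for each $j\in\{1,\ldots,m\}$; the sizes $|S_1|$ and $|S_2|$ differ by at most one; and $$|S_i\cap V_j|\ \geq\ \frac{|V_j|}{2}-1\qquad\text{for all } i\in\{1,2\} \text{ and all } j\in\{1,\ldots,m\}.$$ In particular, the following statement, conjectured by Aharoni et al., is true: there exists an independent set $S$ of $P$ such that $|S\cap V_j|\geq |V_j|/2-1$ for all $j\in\{1,\ldots,m\}$, with strict inequality for at least $m/2$ of the indices $j$. -/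

import Mathlib

/-! Identify the vertices with `Fin n` and apply the octahedral Tucker lemma to sign vectors `x` on
them; the entries `1` and `-1` mark the two sets. Write alt(x) for the length of a longest
alternating subsequence of nonzero entries, i.e. `signChanges 0`. If some class is heavy for `x`,
label `x` by the least heavy class with its prevailing sign; otherwise use m + alt(x) with the sign
of the first nonzero entry (`isTuckerLabelling_pathLabel`).

A Tucker labelling needs absolute values up to n, so some `x` without heavy classes has m + alt(x) ≥
n (`exists_heavyColors_eq_empty`). Having no heavy class makes `x` vanish somewhere in each class,
so alt(x) ≤ |supp x| ≤ n - m. Equality throughout means that the nonzero entries alternate and each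
class contains exactly one zero. Alternation gives independence and near-equal sizes; lightness
bounds each sign by half of each class, hence from below too.

Tucker's lemma is obtained from a parity form of Ky Fan's lemma (`sum_flagLabels`): the number of
maximal chains with alternating labels starting positive is odd, by induction on dimension with
counts in `ZMod 2`. -/

/-! ### Alternating label sequences modulo 2 -/

/-- Order on the integers by absolute value, ties broken by the usual order. -/
def absLE (a b : ℤ) : Prop := a.natAbs < b.natAbs ∨ (a.natAbs = b.natAbs ∧ a ≤ b)

instance : DecidableRel absLE := fun a b => by unfold absLE; infer_instance

instance : IsTrans ℤ absLE := ⟨fun a b c h1 h2 => by unfold absLE at *; omega⟩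

instance : Std.Antisymm absLE := ⟨fun a b h1 h2 => by unfold absLE at *; omega⟩

instance : Std.Total absLE := ⟨fun a b => by unfold absLE at *; omega⟩

/-- Indicator of the lists with absolute values strictly increasing above `b` and with
alternating signs, the first of which is the sign of `s`. -/
def altInd : ℤ → ℕ → List ℤ → ZMod 2
  | _, _, [] => 1
  | s, b, a :: l => if 0 < s * a ∧ b < a.natAbs then altInd (-s) a.natAbs l else 0

/-- The lists obtained by deleting one entry. -/
def faces {α : Type*} : List α → List (List α)
  | [] => []
  | a :: l => l :: (faces l).map (List.cons a)

theorem altInd_of_forall_lt (s : ℤ) {b b' : ℕ} {l : List ℤ}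
    (h : ∀ x ∈ l, b < x.natAbs) (h' : ∀ x ∈ l, b' < x.natAbs) :
    altInd s b l = altInd s b' l := by
  cases l with
  | nil => rfl
  | cons a l =>
    simp only [altInd]
    simp [h a (by simp), h' a (by simp)]

theorem zmod_two_add_self (x : ZMod 2) : x + x = 0 := by
  revert x; decide

theorem sum_faces_altInd_cons (s : ℤ) (b : ℕ) (a : ℤ) (l : List ℤ) :
    ((faces (a :: l)).map (altInd s b)).sum = altInd s b l +
      if 0 < s * a ∧ b < a.natAbs then ((faces l).map (altInd (-s) a.natAbs)).sum else 0 := by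
  simp only [faces, List.map_cons, List.sum_cons, List.map_map]
  congr 1
  split_ifs with h
  · congr 2
    funext t
    simp [altInd, h]
  · have : (altInd s b ∘ List.cons a) = fun _ => 0 := by
      funext t
      simp [altInd, h]
    simp [this]

/-- Deleting the last entry of a nonempty alternating list keeps its starting sign, and deleting the
first reverses it. For other lists the good deletions come in pairs. The hypothesis `hc` makes
entries of equal absolute value equal, so deleting either of two equal neighbours gives the same
list. -/
theorem sum_faces_altInd (s : ℤ) (hs : s ≠ 0) (b : ℕ) (l : List ℤ) (hl : l.Pairwise absLE)
    (hb : ∀ x ∈ l, b < x.natAbs) (hc : ∀ x ∈ l, ∀ y ∈ l, x ≠ -y) :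
    ((faces l).map (altInd s b)).sum = altInd s b l + altInd (-s) b l := by
  induction l generalizing s b with
  | nil => simp only [faces, altInd]; rfl
  | cons a l ih =>
    rw [sum_faces_altInd_cons]
    have hba : b < a.natAbs := hb a (by simp)
    have ha0 : a ≠ 0 := by rintro rfl; simp at hba
    rw [List.pairwise_cons] at hl
    have hbl : ∀ x ∈ l, b < x.natAbs := fun x hx => hb x (by simp [hx])
    have hcl : ∀ x ∈ l, ∀ y ∈ l, x ≠ -y := fun x hx y hy => hc x (by simp [hx]) y (by simp [hy])
    by_cases hlt : ∀ x ∈ l, a.natAbs < x.natAbs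
    · have e1 : ∀ t, altInd t b l = altInd t a.natAbs l := fun t =>
        altInd_of_forall_lt t hbl hlt
      have ih' := ih (-s) (by simpa using hs) a.natAbs hl.2 hlt hcl
      rw [neg_neg] at ih'
      rcases lt_or_gt_of_ne (mul_ne_zero hs ha0) with h | h
      · have h' : 0 < -s * a := by linarith
        have h'' : ¬ 0 < s * a := not_lt.2 h.le
        simp only [altInd, hba, h', h'', and_true, if_true, if_false, add_zero, zero_add, neg_neg,
          e1]
      · have h' : ¬ 0 < -s * a := by linarith
        simp only [altInd, hba, h, h', and_self, if_true, and_true, if_false, add_zero, ih', e1]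
        rw [add_comm (altInd (-s) _ _), ← add_assoc, zmod_two_add_self, zero_add]
    · cases l with
      | nil => simp at hlt
      | cons a' l =>
        -- Sortedness forces a tie of absolute values at the head, and `hc` rules out opposite
        -- entries.
        have haa : a' = a := by
          push Not at hlt
          obtain ⟨x, hx, hxa⟩ := hlt
          have h1 := hl.1 a' (by simp)
          have h2 : absLE a' x := by
            rcases List.mem_cons.1 hx with rfl | hx
            · exact Or.inr ⟨rfl, le_rfl⟩
            · exact (List.pairwise_cons.1 hl.2).1 x hx
          have h3 := hc a' (by simp) a (by simp)
          unfold absLE at h1 h2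
          omega
        subst haa
        have z : ∀ t, altInd t a'.natAbs (a' :: l) = 0 := fun t => by simp [altInd]
        rw [sum_faces_altInd_cons]
        rcases lt_or_gt_of_ne (mul_ne_zero hs ha0) with h | h
        · have h' : ¬ 0 < s * a' := by linarith
          simp only [altInd, hba, h', if_false, lt_irrefl, and_false, and_true, add_zero,
            ite_self]
        · have h' : ¬ 0 < -s * a' := by linarith
          simp only [altInd, hba, h', h, if_true, if_false, lt_irrefl, and_false,
            and_true, add_zero, ite_self]
          exact zmod_two_add_self _

theorem sum_faces_coe {α : Type*} [DecidableEq α] {β : Type*} [AddCommMonoid β]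
    (f : Multiset α → β) (l : List α) :
    ((faces l).map fun t : List α => f (t : Multiset α)).sum =
      ((l : Multiset α).map fun a => f ((l : Multiset α).erase a)).sum := by
  induction l generalizing f with
  | nil => simp [faces]
  | cons a l ih =>
    have := ih (fun M => f (a ::ₘ M))
    rw [← Multiset.cons_coe, Multiset.map_cons, Multiset.sum_cons, Multiset.erase_cons_head,
      faces, List.map_cons, List.sum_cons, List.map_map]
    congr 1
    rw [show ((fun t : List α => f t) ∘ List.cons a) = fun t : List α => f (a ::ₘ (t : Multiset α))
      from rfl, this]
    congr 1
    refine Multiset.map_congr rfl fun x hx => ?_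
    rw [Multiset.erase_cons_tail_of_mem hx]

theorem sublist_of_mem_faces {α : Type*} {l t : List α} (h : t ∈ faces l) : t.Sublist l := by
  induction l generalizing t with
  | nil => simp [faces] at h
  | cons a l ih =>
    simp only [faces, List.mem_cons, List.mem_map] at h
    rcases h with rfl | ⟨u, hu, rfl⟩
    · exact List.sublist_cons_self _ _
    · exact (ih hu).cons_cons a

/-- Indicator of the multisets of integers with distinct absolute values, alternating in sign
when sorted by absolute value, the smallest one having the sign of `s`. -/
noncomputable def multisetAltInd (s : ℤ) (M : Multiset ℤ) : ZMod 2 := altInd s 0 (M.sort absLE)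

theorem multisetAltInd_coe (s : ℤ) {l : List ℤ} (hl : l.Pairwise absLE) :
    multisetAltInd s l = altInd s 0 l := by
  unfold multisetAltInd
  congr 1
  have h1 : ((l : Multiset ℤ).sort absLE).Pairwise absLE := Multiset.pairwise_sort _ _
  have h2 : ((l : Multiset ℤ).sort absLE).Perm l := by
    rw [← Multiset.coe_eq_coe, Multiset.sort_eq]
  exact h2.eq_of_pairwise (fun a b _ _ hab hba => antisymm hab hba) h1 hl

theorem sum_multisetAltInd_erase (s : ℤ) (hs : s ≠ 0) (M : Multiset ℤ)
    (hc : ∀ x ∈ M, ∀ y ∈ M, x ≠ -y) :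
    (M.map fun a => multisetAltInd s (M.erase a)).sum =
      multisetAltInd s M + multisetAltInd (-s) M := by
  have hM : ((M.sort absLE : List ℤ) : Multiset ℤ) = M := Multiset.sort_eq _ _
  have hl : (M.sort absLE).Pairwise absLE := Multiset.pairwise_sort _ _
  generalize M.sort absLE = l at hM hl
  subst hM
  rw [← sum_faces_coe, multisetAltInd_coe _ hl, multisetAltInd_coe _ hl, ← sum_faces_altInd s hs 0 l hl]
  · congr 1
    refine List.map_congr_left fun t ht => ?_
    exact multisetAltInd_coe s (hl.sublist (sublist_of_mem_faces ht))
  · intro x hx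
    have := hc x (by simpa using hx) x (by simpa using hx)
    omega
  · simpa using hc

theorem altInd_map_neg (s : ℤ) (b : ℕ) (l : List ℤ) :
    altInd s b (l.map Neg.neg) = altInd (-s) b l := by
  induction l generalizing s b with
  | nil => rfl
  | cons a l ih => simp [altInd, ih]

/-- Without opposite entries the tie-breaking in `absLE` only compares equal integers, so negation
preserves sortedness. -/
theorem multisetAltInd_neg (s : ℤ) (M : Multiset ℤ) (hc : ∀ x ∈ M, ∀ y ∈ M, x ≠ -y) :
    multisetAltInd s (M.map Neg.neg) = multisetAltInd (-s) M := by
  have hM : ((M.sort absLE : List ℤ) : Multiset ℤ) = M := Multiset.sort_eq _ _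
  have hl : (M.sort absLE).Pairwise absLE := Multiset.pairwise_sort _ _
  generalize M.sort absLE = l at hM hl
  subst hM
  rw [Multiset.map_coe, multisetAltInd_coe _ hl, multisetAltInd_coe, altInd_map_neg]
  rw [List.pairwise_map]
  refine hl.imp_of_mem fun {a b} ha hb h => ?_
  have := hc a (by simpa using ha) b (by simpa using hb)
  unfold absLE at *
  omega

theorem pairwise_of_altInd_ne_zero (s : ℤ) (b : ℕ) (l : List ℤ) (h : altInd s b l ≠ 0) :
    ((l.map Int.natAbs).Pairwise (· < ·)) ∧ ∀ x ∈ l, b < x.natAbs := by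
  induction l generalizing s b with
  | nil => simp
  | cons a l ih =>
    simp only [altInd] at h
    split_ifs at h with h1
    · have := ih _ _ h
      simp only [List.map_cons, List.pairwise_cons, List.mem_map, List.mem_cons]
      refine ⟨⟨?_, this.1⟩, ?_⟩
      · rintro _ ⟨x, hx, rfl⟩
        exact this.2 x hx
      · rintro x (rfl | hx)
        · exact h1.2
        · exact h1.2.trans (this.2 x hx)
    · exact absurd rfl h

theorem card_le_of_multisetAltInd_ne_zero (s : ℤ) (M : Multiset ℤ) (h : multisetAltInd s M ≠ 0)
    (N : ℕ) (hN : ∀ x ∈ M, x.natAbs ≤ N) : Multiset.card M ≤ N := by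
  obtain ⟨h1, h2⟩ := pairwise_of_altInd_ne_zero _ _ _ h
  have h3 : ((M.sort absLE).map Int.natAbs).Nodup := h1.imp fun h => h.ne
  have h4 : ((M.sort absLE).map Int.natAbs).toFinset ⊆ Finset.Icc 1 N := by
    intro y hy
    simp only [List.mem_toFinset, List.mem_map] at hy
    obtain ⟨x, hx, rfl⟩ := hy
    rw [Finset.mem_Icc]
    exact ⟨h2 x hx, hN x ((Multiset.mem_sort _).1 hx)⟩
  have h5 := Finset.card_le_card h4
  rw [List.toFinset_card_of_nodup h3] at h5
  simpa using h5

/-! ### Maximal chains of sign vectors -/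

/-- The sign vector `x` is obtained from `y` by erasing entries. -/
def SignLE {ι : Type*} (x y : ι → SignType) : Prop := ∀ i, x i ≠ 0 → y i = x i

/-- A Boolean as a nonzero sign. -/
def boolSign (b : Bool) : SignType := if b then 1 else -1

/-- The `j`-th sign vector, in decreasing order, of the maximal chain of nonzero sign vectors
given by a ranking `p` of the coordinates and a choice `ε` of signs. -/
def flagVec {k : ℕ} (p : Equiv.Perm (Fin k)) (ε : Fin k → Bool) (j : Fin k) : Fin k → SignType :=
  fun c => if j ≤ p c then boolSign (ε c) else 0

theorem boolSign_ne_zero (b : Bool) : boolSign b ≠ 0 := by cases b <;> decide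

theorem boolSign_not (b : Bool) : boolSign (!b) = -boolSign b := by cases b <;> decide

theorem flagVec_ne_zero {k : ℕ} (p : Equiv.Perm (Fin k)) (ε : Fin k → Bool) (j : Fin k) :
    flagVec p ε j ≠ 0 := by
  intro h
  have := congrFun h (p.symm j)
  simp [flagVec, boolSign_ne_zero] at this

theorem flagVec_le {k : ℕ} (p : Equiv.Perm (Fin k)) (ε : Fin k → Bool) {i j : Fin k} (h : i ≤ j) :
    SignLE (flagVec p ε j) (flagVec p ε i) := by
  intro c hc
  unfold flagVec at *
  split_ifs at * with h1 h2 <;> first | rfl | (exfalso; first | exact hc rfl | omega)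

theorem flagVec_not {k : ℕ} (p : Equiv.Perm (Fin k)) (ε : Fin k → Bool) (j : Fin k) :
    flagVec p (fun c => !ε c) j = -flagVec p ε j := by
  funext c
  simp only [flagVec, Pi.neg_apply, boolSign_not]
  split_ifs <;> simp

/-- A labelling of the nonzero sign vectors as in the octahedral Tucker lemma. -/
structure IsTuckerLabelling {ι : Type*} (lam : (ι → SignType) → ℤ) : Prop where
  neg : ∀ x, x ≠ 0 → lam (-x) = -lam x
  ne : ∀ x y, x ≠ 0 → SignLE x y → lam x ≠ -lam y

/-- The labels of the chain given by `p` and `ε`, except the one at `j`. -/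
def faceLabels {k : ℕ} (lam : (Fin k → SignType) → ℤ) (j : Fin k)
    (a : Equiv.Perm (Fin k) × (Fin k → Bool)) : Multiset ℤ :=
  ((Finset.univ.erase j).val).map fun i => lam (flagVec a.1 a.2 i)

/-- The labels of the chain given by `p` and `ε`. -/
def flagLabels {k : ℕ} (lam : (Fin k → SignType) → ℤ)
    (a : Equiv.Perm (Fin k) × (Fin k → Bool)) : Multiset ℤ :=
  (Finset.univ.val).map fun i => lam (flagVec a.1 a.2 i)

theorem IsTuckerLabelling.flagLabels_ne {k : ℕ} {lam : (Fin k → SignType) → ℤ}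
    (h : IsTuckerLabelling lam) (a : Equiv.Perm (Fin k) × (Fin k → Bool)) :
    ∀ x ∈ flagLabels lam a, ∀ y ∈ flagLabels lam a, x ≠ -y := by
  intro x hx y hy
  simp only [flagLabels, Multiset.mem_map] at hx hy
  obtain ⟨i, -, rfl⟩ := hx
  obtain ⟨j, -, rfl⟩ := hy
  rcases le_total i j with hij | hij
  · have := h.ne _ _ (flagVec_ne_zero a.1 a.2 j) (flagVec_le a.1 a.2 hij)
    omega
  · exact h.ne _ _ (flagVec_ne_zero a.1 a.2 i) (flagVec_le a.1 a.2 hij)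

/-- The boundary identity for one chain: the term with sign `-1` is the contribution of the
antipodal chain. -/
theorem sum_faceLabels {k : ℕ} {lam : (Fin k → SignType) → ℤ}
    (h : IsTuckerLabelling lam) (a : Equiv.Perm (Fin k) × (Fin k → Bool)) :
    ∑ j, multisetAltInd 1 (faceLabels lam j a) =
      multisetAltInd 1 (flagLabels lam a) +
      multisetAltInd 1 (flagLabels lam (a.1, fun c => !a.2 c)) := by
  have e : flagLabels lam (a.1, fun c => !a.2 c) = (flagLabels lam a).map Neg.neg := by
    simp only [flagLabels, Multiset.map_map]
    refine Multiset.map_congr rfl fun i _ => ?_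
    simp only [flagVec_not, Function.comp]
    exact h.neg _ (flagVec_ne_zero _ _ _)
  rw [e, multisetAltInd_neg _ _ (h.flagLabels_ne a), ← sum_multisetAltInd_erase 1 one_ne_zero _
    (h.flagLabels_ne a)]
  conv_rhs => rw [flagLabels, Multiset.map_map]
  rw [Finset.sum]
  congr 1
  refine Multiset.map_congr rfl fun j _ => ?_
  simp only [Function.comp]
  congr 1
  have : (Finset.univ : Finset (Fin k)).val = j ::ₘ (Finset.univ.erase j).val := by
    rw [Finset.erase_val, Multiset.cons_erase (Finset.mem_univ_val j)]
  rw [this, Multiset.map_cons, Multiset.erase_cons_head]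
  rfl

theorem faceLabels_congr {k : ℕ} {lam : (Fin k → SignType) → ℤ} {j : Fin k}
    {a b : Equiv.Perm (Fin k) × (Fin k → Bool)}
    (h : ∀ i, i ≠ j → flagVec a.1 a.2 i = flagVec b.1 b.2 i) :
    faceLabels lam j a = faceLabels lam j b := by
  refine Multiset.map_congr rfl fun i hi => ?_
  rw [h i (Finset.ne_of_mem_erase (Finset.mem_def.2 hi))]

/-- Interior faces cancel: exchanging two consecutive ranks changes only the omitted vector, which
pairs the two chains sharing the face. The sign of coordinate `0`, fixed to select a hemisphere, is
untouched. -/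
theorem sum_faceLabels_succ {k : ℕ} (lam : (Fin (k + 1) → SignType) → ℤ) (j : Fin k) :
    ∑ a : Equiv.Perm (Fin (k + 1)) × (Fin (k + 1) → Bool) with a.2 0 = true,
      multisetAltInd 1 (faceLabels lam j.succ a) = 0 := by
  refine Finset.sum_involution (fun a _ => (Equiv.swap j.castSucc j.succ * a.1, a.2)) ?_ ?_ ?_ ?_
  · intro a _
    rw [faceLabels_congr (b := (Equiv.swap j.castSucc j.succ * a.1, a.2)), zmod_two_add_self]
    intro i hi
    funext c
    have : i ≤ Equiv.swap j.castSucc j.succ (a.1 c) ↔ i ≤ a.1 c := by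
      rw [Equiv.swap_apply_def]
      split_ifs with h1 h2
      · rw [h1]
        simp only [Fin.le_def, Fin.ext_iff, ne_eq, Fin.val_succ, Fin.val_castSucc] at *
        omega
      · rw [h2]
        simp only [Fin.le_def, Fin.ext_iff, ne_eq, Fin.val_succ, Fin.val_castSucc] at *
        omega
      · rfl
    simp [flagVec, this]
  · intro a _ _ h
    have h1 : Equiv.swap j.castSucc j.succ * a.1 = a.1 := congrArg Prod.fst h
    rw [mul_eq_right, Equiv.swap_eq_one_iff] at h1
    simp [Fin.ext_iff] at h1
  · intro a ha
    simpa using ha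
  · intro a _
    ext1 <;> simp

/-- Omitting the full-support vector hides the sign of the rank-`0` coordinate. Flipping that sign
cancels chains in pairs unless this is coordinate `0`, whose sign is fixed. The surviving faces are
the maximal chains of the equator, where coordinate `0` vanishes. -/
theorem sum_faceLabels_zero {k : ℕ} (lam : (Fin (k + 1) → SignType) → ℤ) :
    ∑ a : Equiv.Perm (Fin (k + 1)) × (Fin (k + 1) → Bool) with a.2 0 = true,
      multisetAltInd 1 (faceLabels lam 0 a) =
    ∑ a : Equiv.Perm (Fin k) × (Fin k → Bool),
      multisetAltInd 1 (flagLabels (fun x => lam (Fin.cons 0 x)) a) := by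
  rw [← Finset.sum_filter_add_sum_filter_not _ (fun a => a.1 0 = 0)]
  have h0 : ∑ a ∈ {a ∈ {a : Equiv.Perm (Fin (k + 1)) × (Fin (k + 1) → Bool) | a.2 0 = true} |
      ¬ a.1 0 = 0}, multisetAltInd 1 (faceLabels lam 0 a) = 0 := by
    refine Finset.sum_involution
      (fun a _ => (a.1, Function.update a.2 (a.1.symm 0) (!a.2 (a.1.symm 0)))) ?_ ?_ ?_ ?_
    · intro a _
      rw [faceLabels_congr
        (b := (a.1, Function.update a.2 (a.1.symm 0) (!a.2 (a.1.symm 0)))), zmod_two_add_self]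
      intro i hi
      funext c
      simp only [flagVec]
      split_ifs with h
      · rw [Function.update_of_ne]
        rintro rfl
        simp only [Equiv.apply_symm_apply] at h
        exact hi (le_antisymm h (Fin.zero_le _))
      · rfl
    · intro a _ _ h
      have h1 := congrFun (congrArg Prod.snd h) (a.1.symm 0)
      simp at h1
    · intro a ha
      simp only [Finset.mem_filter, Finset.mem_univ, true_and] at ha ⊢
      refine ⟨?_, ha.2⟩
      rw [Function.update_of_ne, ha.1]
      intro h
      exact ha.2 (by conv_lhs => rw [h]
                     simp)
    · intro a _
      ext1
      · rfl
      · simp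
  rw [h0, add_zero]
  symm
  refine Finset.sum_bij
    (fun a _ => (Equiv.Perm.decomposeFin.symm (0, a.1), Fin.cons true a.2)) ?_ ?_ ?_ ?_
  · intro a _
    simp
  · intro a _ b _ h
    simp only [Prod.mk.injEq, EmbeddingLike.apply_eq_iff_eq, true_and] at h
    exact Prod.ext h.1 (Fin.cons_right_injective _ h.2)
  · intro b hb
    simp only [Finset.mem_filter, Finset.mem_univ, true_and] at hb
    obtain ⟨⟨q, r⟩, hq⟩ : ∃ q, Equiv.Perm.decomposeFin.symm q = b.1 :=
      ⟨Equiv.Perm.decomposeFin b.1, by simp⟩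
    have hq0 : q = 0 := by
      have := hb.2
      rw [← hq] at this
      simpa using this
    subst hq0
    refine ⟨(r, Fin.tail b.2), Finset.mem_univ _, ?_⟩
    ext1
    · exact hq
    · simp only
      rw [← hb.1, Fin.cons_self_tail]
  · intro a _
    congr 1
    simp only [flagLabels, faceLabels]
    rw [show (Finset.univ.erase (0 : Fin (k + 1))) = Finset.univ.map (Fin.succEmb k) by
      ext i
      simp only [Finset.mem_erase, Finset.mem_univ, and_true, Finset.mem_map, true_and]
      exact ⟨fun h => ⟨i.pred h, by simp⟩, by rintro ⟨j, rfl⟩; exact Fin.succ_ne_zero j⟩,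
      Finset.map_val, Multiset.map_map]
    refine Multiset.map_congr rfl fun i _ => ?_
    simp only [Function.comp]
    congr 1
    funext c
    refine Fin.cases ?_ (fun c => ?_) c
    · simp [flagVec]
    · simp [flagVec]

theorem IsTuckerLabelling.cons {k : ℕ} {lam : (Fin (k + 1) → SignType) → ℤ}
    (h : IsTuckerLabelling lam) : IsTuckerLabelling fun x : Fin k → SignType =>
      lam (Fin.cons 0 x) := by
  have key : ∀ x : Fin k → SignType, x ≠ 0 →
      (Fin.cons 0 x : Fin (k + 1) → SignType) ≠ 0 := by
    intro x hx h0
    refine hx (funext fun i => ?_)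
    simpa using congrFun h0 i.succ
  refine ⟨fun x hx => ?_, fun x y hx hxy => h.ne _ _ (key x hx) fun i => ?_⟩
  · rw [← h.neg _ (key x hx)]
    congr 1
    funext i
    refine Fin.cases ?_ (fun i => ?_) i <;> simp
  · refine Fin.cases ?_ (fun i => ?_) i
    · simp
    · simpa using hxy i

/-! ### Ky Fan's and Tucker's lemmas -/

/-- **Ky Fan's lemma**, parity version, for sign vectors. -/
theorem sum_flagLabels {k : ℕ} (lam : (Fin k → SignType) → ℤ) (h : IsTuckerLabelling lam) :
    ∑ a : Equiv.Perm (Fin k) × (Fin k → Bool), multisetAltInd 1 (flagLabels lam a) = 1 := by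
  induction k with
  | zero => simp [flagLabels, multisetAltInd, altInd]
  | succ k ih =>
    rw [← ih _ h.cons, ← sum_faceLabels_zero]
    have e1 : ∑ a : Equiv.Perm (Fin (k + 1)) × (Fin (k + 1) → Bool) with a.2 0 = true,
        ∑ j, multisetAltInd 1 (faceLabels lam j a) =
        ∑ a : Equiv.Perm (Fin (k + 1)) × (Fin (k + 1) → Bool) with a.2 0 = true,
          multisetAltInd 1 (faceLabels lam 0 a) := by
      rw [Finset.sum_comm, Fin.sum_univ_succ, Finset.sum_eq_zero (s := (Finset.univ : Finset (Fin k)))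
          fun j _ => sum_faceLabels_succ lam j, add_zero]
    -- Each hemisphere chain contributes itself and its antipode, so together they exhaust all
    -- chains.
    rw [← e1, Finset.sum_congr rfl fun a _ => sum_faceLabels h a, Finset.sum_add_distrib,
      ← Finset.sum_filter_add_sum_filter_not _ (fun a => a.2 0 = true)]
    congr 1
    refine Finset.sum_bij (fun a _ => (a.1, fun c => !a.2 c)) ?_ ?_ ?_ ?_
    · intro a ha
      simpa using ha
    · intro a _ b _ hab
      simp only [Prod.mk.injEq] at hab
      refine Prod.ext hab.1 (funext fun c => ?_)
      simpa using congrFun hab.2 c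
    · intro b hb
      exact ⟨(b.1, fun c => !b.2 c), by simpa using hb, by simp⟩
    · intro a _
      simp

/-- **Octahedral Tucker lemma**. -/
theorem IsTuckerLabelling.le {n : ℕ} {lam : (Fin n → SignType) → ℤ} (h : IsTuckerLabelling lam)
    (N : ℕ) (hN : ∀ x, x ≠ 0 → (lam x).natAbs ≤ N) : n ≤ N := by
  obtain ⟨a, -, ha⟩ := Finset.exists_ne_zero_of_sum_ne_zero
    (by rw [sum_flagLabels lam h]; exact one_ne_zero)
  have := card_le_of_multisetAltInd_ne_zero 1 _ ha N (by
    intro x hx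
    simp only [flagLabels, Multiset.mem_map] at hx
    obtain ⟨i, -, rfl⟩ := hx
    exact hN _ (flagVec_ne_zero _ _ _))
  simpa [flagLabels] using this

/-! ### Sign changes and alternation -/

/-- The number of sign changes in a list of signs, zeros being ignored, when started from `s`. -/
def signChanges : SignType → List SignType → ℕ
  | _, [] => 0
  | s, a :: l => if a = 0 ∨ a = s then signChanges s l else signChanges a l + 1

theorem signChanges_le_succ (s t : SignType) (l : List SignType) :
    signChanges s l ≤ signChanges t l + 1 := by
  induction l generalizing s t with
  | nil => simp [signChanges]
  | cons a l ih =>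
    simp only [signChanges]
    have h1 := ih s t
    have h2 := ih s a
    split_ifs with h3 h4 h4
    · exact h1
    · omega
    · rcases h4 with h4 | h4
      · exact absurd (Or.inl h4) h3
      · rw [h4]
    · omega

theorem signChanges_mono (s : SignType) {l l' : List SignType}
    (h : List.Forall₂ (fun a b => a ≠ 0 → b = a) l l') :
    signChanges s l ≤ signChanges s l' := by
  induction h generalizing s with
  | nil => exact le_rfl
  | @cons a b l l' hab _ ih =>
    simp only [signChanges]
    by_cases ha : a = 0
    · simp only [ha, true_or, if_true]
      split_ifs
      · exact ih s
      · exact (ih s).trans (signChanges_le_succ _ _ _)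
    · obtain rfl := hab ha
      split_ifs
      · exact ih s
      · exact Nat.succ_le_succ (ih _)

theorem signChanges_neg (s : SignType) (l : List SignType) :
    signChanges s (l.map Neg.neg) = signChanges (-s) l := by
  induction l generalizing s with
  | nil => rfl
  | cons a l ih =>
    simp only [List.map_cons, signChanges, ih, neg_neg]
    have h1 : -a = 0 ↔ a = 0 := by revert a; decide
    have h2 : -a = s ↔ a = -s := by revert a s; decide
    simp only [h1, h2]

/-- Starting from `0`, the first nonzero entry counts as a change; starting from `1` or `-1`, it
counts only if it differs. The difference of the latter two counts thus encodes the first nonzero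
sign. -/
theorem signChanges_zero (l : List SignType) (hl : ∃ a ∈ l, a ≠ 0) :
    (signChanges (-1) l = signChanges 0 l ∧ signChanges 1 l + 1 = signChanges 0 l) ∨
    (signChanges 1 l = signChanges 0 l ∧ signChanges (-1) l + 1 = signChanges 0 l) := by
  induction l with
  | nil => simp at hl
  | cons a l ih =>
    cases a using SignType.rec
    · have := ih (by simpa using hl)
      simpa [signChanges] using this
    · right
      simp [signChanges]
    · left
      simp [signChanges]

theorem signChanges_le (s : SignType) (l : List SignType) :
    signChanges s l ≤ l.countP (· ≠ 0) := by
  induction l generalizing s with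
  | nil => simp [signChanges]
  | cons a l ih =>
    simp only [signChanges, List.countP_cons]
    have h1 := ih s
    have h2 := ih a
    by_cases ha : a = 0
    · simpa [ha] using h1
    · simp only [ha, false_or, ne_eq, not_false_eq_true, decide_true, if_true] at h1 h2 ⊢
      split_ifs <;> omega

/-- Equality means that every nonzero entry registers as a change. The clause on the head carries
the induction. -/
theorem isChain_of_signChanges_eq (s : SignType) (l : List SignType)
    (h : signChanges s l = l.countP (· ≠ 0)) :
    l.IsChain (fun a b => a ≠ 0 → a ≠ b) ∧ (s ≠ 0 → ∀ a ∈ l.head?, a ≠ s) := by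
  induction l generalizing s with
  | nil => simp
  | cons a l ih =>
    simp only [signChanges, List.countP_cons] at h
    have h1 := signChanges_le s l
    split_ifs at h with h2 h3 h3
    · simp at h3; omega
    · have ha : a = 0 := by simpa using h3
      subst ha
      obtain ⟨h4, -⟩ := ih s (by omega)
      refine ⟨?_, fun hs b hb => ?_⟩
      · rw [List.isChain_cons]
        exact ⟨fun _ _ h => absurd rfl h, h4⟩
      · simp at hb
        rw [← hb]
        exact hs.symm
    · push Not at h2
      obtain ⟨h4, h5⟩ := ih a (by omega)
      refine ⟨?_, fun hs b hb => ?_⟩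
      · rw [List.isChain_cons]
        exact ⟨fun b hb _ => (h5 h2.1 b hb).symm, h4⟩
      · simp at hb
        rw [← hb]
        exact h2.2
    · simp at h3
      exact absurd (Or.inl h3) h2

theorem count_of_signChanges_eq (l : List SignType) (s : SignType)
    (h : signChanges s l = l.countP (· ≠ 0)) :
    (s ≠ 1 → l.count 1 ≤ l.count (-1) + 1) ∧ (s ≠ -1 → l.count (-1) ≤ l.count 1 + 1) ∧
    (s = 1 → l.count 1 ≤ l.count (-1)) ∧ (s = -1 → l.count (-1) ≤ l.count 1) := by
  induction l generalizing s with
  | nil => simp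
  | cons a l ih =>
    simp only [signChanges, List.countP_cons] at h
    have h1 := signChanges_le s l
    split_ifs at h with h2 h3 h3
    · simp at h3; omega
    · have ha : a = 0 := by simpa using h3
      subst ha
      have := ih s (by omega)
      simpa using this
    · have := ih a (by omega)
      simp only [List.count_cons]
      revert h2 this
      generalize List.count 1 l = p
      generalize List.count (-1) l = q
      rcases a with _ | _ | _ <;> rcases s with _ | _ | _ <;> simp <;> omega
    · simp at h3
      exact absurd (Or.inl h3) h2

/-! ### The Tucker labelling of a colored path -/

section Label

variable {n m : ℕ}

/-- The number of indices of color `j` at which `x` takes the value `s`. -/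
def colorCount (c : Fin n → Fin m) (s : SignType) (j : Fin m) (x : Fin n → SignType) : ℕ :=
  (Finset.univ.filter fun i => c i = j ∧ x i = s).card

/-- The number of indices of color `j`. -/
def colorCard (c : Fin n → Fin m) (j : Fin m) : ℕ := (Finset.univ.filter fun i => c i = j).card

/-- The colors at least half of which is covered by one sign, except that covering exactly half
counts only when the other sign covers the other half. -/
def heavyColors (c : Fin n → Fin m) (x : Fin n → SignType) : Finset (Fin m) :=
  Finset.univ.filter fun j => colorCard c j < 2 * colorCount c 1 j x ∨
    colorCard c j < 2 * colorCount c (-1) j x ∨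
    (colorCard c j = 2 * colorCount c 1 j x ∧ colorCard c j = 2 * colorCount c (-1) j x)

/-- The sign that prevails in color `j`, ties being broken by the value at `r j`. -/
def colorSign (c : Fin n → Fin m) (r : Fin m → Fin n) (j : Fin m) (x : Fin n → SignType) :
    SignType :=
  if colorCount c 1 j x = colorCount c (-1) j x then x (r j)
  else if colorCount c (-1) j x < colorCount c 1 j x then 1 else -1

/-- The labelling to which the octahedral Tucker lemma is applied. -/
def pathLabel (c : Fin n → Fin m) (r : Fin m → Fin n) (x : Fin n → SignType) : ℤ :=
  if h : (heavyColors c x).Nonempty then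
    (((heavyColors c x).min' h : ℕ) + 1 : ℤ) * (colorSign c r ((heavyColors c x).min' h) x : ℤ)
  else ((m : ℤ) + signChanges 0 (List.ofFn x)) *
    ((signChanges (-1) (List.ofFn x) : ℤ) - signChanges 1 (List.ofFn x))

variable (c : Fin n → Fin m) (r : Fin m → Fin n)

theorem colorCount_neg (s : SignType) (j : Fin m) (x : Fin n → SignType) :
    colorCount c s j (-x) = colorCount c (-s) j x := by
  unfold colorCount
  congr 1
  ext i
  simp only [Finset.mem_filter, Finset.mem_univ, true_and, Pi.neg_apply]
  rw [neg_eq_iff_eq_neg]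

theorem heavyColors_neg (x : Fin n → SignType) : heavyColors c (-x) = heavyColors c x := by
  ext j
  simp only [heavyColors, Finset.mem_filter, Finset.mem_univ, true_and, colorCount_neg, neg_neg]
  tauto

theorem colorSign_neg (j : Fin m) (x : Fin n → SignType) :
    colorSign c r j (-x) = -colorSign c r j x := by
  simp only [colorSign, colorCount_neg, neg_neg, Pi.neg_apply]
  split_ifs <;> first | rfl | omega

theorem colorCount_mono {s : SignType} (hs : s ≠ 0) (j : Fin m) {x y : Fin n → SignType}
    (h : SignLE x y) : colorCount c s j x ≤ colorCount c s j y := by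
  refine Finset.card_le_card fun i hi => ?_
  simp only [Finset.mem_filter, Finset.mem_univ, true_and] at hi ⊢
  exact ⟨hi.1, by rw [h i (by rw [hi.2]; exact hs), hi.2]⟩

theorem colorCount_add (j : Fin m) (x : Fin n → SignType) :
    colorCount c 0 j x + colorCount c 1 j x + colorCount c (-1) j x = colorCard c j := by
  unfold colorCount colorCard
  rw [← Finset.card_union_of_disjoint, ← Finset.card_union_of_disjoint]
  · congr 1
    ext i
    simp only [Finset.mem_union, Finset.mem_filter, Finset.mem_univ, true_and]
    rcases x i with _ | _ | _ <;> simp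
  · rw [Finset.disjoint_left]
    intro i hi hi'
    simp only [Finset.mem_union, Finset.mem_filter, Finset.mem_univ, true_and] at hi hi'
    revert hi hi'
    rcases x i with _ | _ | _ <;> simp
  · rw [Finset.disjoint_left]
    intro i hi hi'
    simp only [Finset.mem_filter, Finset.mem_univ, true_and] at hi hi'
    revert hi hi'
    rcases x i with _ | _ | _ <;> simp

theorem heavyColors_mono {x y : Fin n → SignType} (h : SignLE x y) :
    heavyColors c x ⊆ heavyColors c y := by
  intro j hj
  simp only [heavyColors, Finset.mem_filter, Finset.mem_univ, true_and] at hj ⊢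
  have h1 := colorCount_mono c one_ne_zero j h
  have h2 := colorCount_mono c (s := -1) (by decide) j h
  have h3 := colorCount_add c j x
  have h4 := colorCount_add c j y
  omega

/-- A tied heavy color is split exactly in half, so it has no zeros and its representative can break
the tie. -/
theorem ne_zero_of_heavy {j : Fin m} (hr : c (r j) = j) {x : Fin n → SignType}
    (hj : j ∈ heavyColors c x) (h : colorCount c 1 j x = colorCount c (-1) j x) :
    x (r j) ≠ 0 := by
  intro h0
  have h1 : 0 < colorCount c 0 j x := Finset.card_pos.2 ⟨r j, by simp [hr, h0]⟩
  have h3 := colorCount_add c j x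
  simp only [heavyColors, Finset.mem_filter, Finset.mem_univ, true_and] at hj
  omega

theorem colorSign_ne_zero {j : Fin m} (hr : c (r j) = j) {x : Fin n → SignType}
    (hj : j ∈ heavyColors c x) : colorSign c r j x ≠ 0 := by
  unfold colorSign
  split_ifs with h1 h2
  · exact ne_zero_of_heavy c r hr hj h1
  · decide
  · decide

/-- A strict majority persists when entries are added, and an exact split leaves no entry of that
color to add. -/
theorem colorSign_mono {j : Fin m} (hr : c (r j) = j) {x y : Fin n → SignType} (h : SignLE x y)
    (hj : j ∈ heavyColors c x) : colorSign c r j y = colorSign c r j x := by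
  have h0 := ne_zero_of_heavy c r hr hj
  simp only [heavyColors, Finset.mem_filter, Finset.mem_univ, true_and] at hj
  have h1 := colorCount_mono c one_ne_zero j h
  have h2 := colorCount_mono c (s := -1) (by decide) j h
  have h3 := colorCount_add c j x
  have h4 := colorCount_add c j y
  unfold colorSign
  split_ifs with h5 h6 h7 <;> first | rfl | omega | exact h _ (h0 h6)

theorem signChanges_ofFn_neg (s : SignType) (x : Fin n → SignType) :
    signChanges s (List.ofFn (-x)) = signChanges (-s) (List.ofFn x) := by
  rw [← signChanges_neg, List.map_ofFn]
  rfl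

theorem signChanges_ofFn_mono (s : SignType) {x y : Fin n → SignType} (h : SignLE x y) :
    signChanges s (List.ofFn x) ≤ signChanges s (List.ofFn y) := by
  refine signChanges_mono s ?_
  rw [List.forall₂_iff_get]
  refine ⟨by simp, fun i h1 h2 => ?_⟩
  simpa using h ⟨i, by simpa using h1⟩

theorem signChanges_ofFn_zero {x : Fin n → SignType} (hx : x ≠ 0) :
    (signChanges (-1) (List.ofFn x) = signChanges 0 (List.ofFn x) ∧
      signChanges 1 (List.ofFn x) + 1 = signChanges 0 (List.ofFn x)) ∨
    (signChanges 1 (List.ofFn x) = signChanges 0 (List.ofFn x) ∧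
      signChanges (-1) (List.ofFn x) + 1 = signChanges 0 (List.ofFn x)) := by
  obtain ⟨i, hi⟩ := Function.ne_iff.1 hx
  exact signChanges_zero _ ⟨x i, by simp, hi⟩

theorem pathLabel_of_nonempty {x : Fin n → SignType} (h : (heavyColors c x).Nonempty) :
    pathLabel c r x = (((heavyColors c x).min' h : ℕ) + 1 : ℤ) *
      (colorSign c r ((heavyColors c x).min' h) x : ℤ) := dif_pos h

theorem pathLabel_of_eq_empty {x : Fin n → SignType} (h : heavyColors c x = ∅) :
    pathLabel c r x = ((m : ℤ) + signChanges 0 (List.ofFn x)) *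
      ((signChanges (-1) (List.ofFn x) : ℤ) - signChanges 1 (List.ofFn x)) :=
  dif_neg (by simp [h])

theorem sign_cast_eq {s : SignType} (hs : s ≠ 0) : (s : ℤ) = 1 ∨ (s : ℤ) = -1 := by
  revert s; decide

theorem isTuckerLabelling_pathLabel (hr : ∀ j, c (r j) = j) :
    IsTuckerLabelling (pathLabel c r) := by
  constructor
  · intro x hx
    rcases (heavyColors c x).eq_empty_or_nonempty with h | h
    · rw [pathLabel_of_eq_empty c r h, pathLabel_of_eq_empty c r (by rw [heavyColors_neg, h])]
      simp only [signChanges_ofFn_neg, neg_neg, neg_zero]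
      ring
    · have h' : (heavyColors c (-x)).Nonempty := by rwa [heavyColors_neg]
      rw [pathLabel_of_nonempty c r h, pathLabel_of_nonempty c r h']
      simp only [heavyColors_neg, colorSign_neg, SignType.coe_neg]
      ring
  · intro x y hx hxy heq
    have hy : y ≠ 0 := by
      obtain ⟨i, hi⟩ := Function.ne_iff.1 hx
      exact Function.ne_iff.2 ⟨i, by rw [hxy i hi]; exact hi⟩
    -- Light labels exceed `m` in absolute value, so they never collide with heavy ones.
    have key : ∀ z : Fin n → SignType, z ≠ 0 → heavyColors c z = ∅ →
        m + 1 ≤ (pathLabel c r z).natAbs := by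
      intro z hz h
      rw [pathLabel_of_eq_empty c r h, Int.natAbs_mul]
      rcases signChanges_ofFn_zero hz with ⟨h1, h2⟩ | ⟨h1, h2⟩
      · rw [show ((signChanges (-1) (List.ofFn z) : ℤ) - signChanges 1 (List.ofFn z)) = 1 by omega,
          Int.natAbs_one, mul_one]
        omega
      · rw [show ((signChanges (-1) (List.ofFn z) : ℤ) - signChanges 1 (List.ofFn z)) = -1 by omega,
          Int.natAbs_neg, Int.natAbs_one, mul_one]
        omega
    rcases (heavyColors c x).eq_empty_or_nonempty with h | h
    · rcases (heavyColors c y).eq_empty_or_nonempty with h' | h'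
      · rw [pathLabel_of_eq_empty c r h, pathLabel_of_eq_empty c r h'] at heq
        -- Opposite labels would mean equal alt but different first signs, contradicting
        -- monotonicity of the count started at the first sign of `y`, or at its opposite.
        have m0 := signChanges_ofFn_mono 0 hxy
        have m1 := signChanges_ofFn_mono 1 hxy
        have m2 := signChanges_ofFn_mono (-1) hxy
        revert heq
        rcases signChanges_ofFn_zero hx with ⟨h1, h2⟩ | ⟨h1, h2⟩ <;>
        rcases signChanges_ofFn_zero hy with ⟨h3, h4⟩ | ⟨h3, h4⟩
        · rw [show ((signChanges (-1) (List.ofFn x) : ℤ) - signChanges 1 (List.ofFn x)) = 1 by omega,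
            show ((signChanges (-1) (List.ofFn y) : ℤ) - signChanges 1 (List.ofFn y)) = 1 by omega]
          omega
        · rw [show ((signChanges (-1) (List.ofFn x) : ℤ) - signChanges 1 (List.ofFn x)) = 1 by omega,
            show ((signChanges (-1) (List.ofFn y) : ℤ) - signChanges 1 (List.ofFn y)) = -1 by omega]
          omega
        · rw [show ((signChanges (-1) (List.ofFn x) : ℤ) - signChanges 1 (List.ofFn x)) = -1 by omega,
            show ((signChanges (-1) (List.ofFn y) : ℤ) - signChanges 1 (List.ofFn y)) = 1 by omega]
          omega
        · rw [show ((signChanges (-1) (List.ofFn x) : ℤ) - signChanges 1 (List.ofFn x)) = -1 by omega,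
            show ((signChanges (-1) (List.ofFn y) : ℤ) - signChanges 1 (List.ofFn y)) = -1 by omega]
          omega
      · have h1 := key x hx h
        rw [heq, pathLabel_of_nonempty c r h'] at h1
        have h2 := ((heavyColors c y).min' h').isLt
        rcases sign_cast_eq (colorSign_ne_zero c r (hr _) (Finset.min'_mem _ h')) with h3 | h3 <;>
        · rw [h3] at h1
          omega
    · have h' : (heavyColors c y).Nonempty := h.mono (heavyColors_mono c hxy)
      rw [pathLabel_of_nonempty c r h, pathLabel_of_nonempty c r h'] at heq
      have hjx := Finset.min'_mem _ h
      have hjy := Finset.min'_mem _ h'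
      generalize (heavyColors c x).min' h = jx at *
      generalize (heavyColors c y).min' h' = jy at *
      have hj : jx = jy := by
        rcases sign_cast_eq (colorSign_ne_zero c r (hr _) hjx) with h3 | h3 <;>
        rcases sign_cast_eq (colorSign_ne_zero c r (hr _) hjy) with h4 | h4 <;>
        · rw [h3, h4] at heq
          omega
      subst hj
      rw [colorSign_mono c r (hr _) hxy hjx] at heq
      rcases sign_cast_eq (colorSign_ne_zero c r (hr _) hjx) with h3 | h3 <;>
      · rw [h3] at heq
        omega

/-! ### Extracting the fair sign vector -/

theorem colorCount_lt_of_heavyColors_eq_empty {x : Fin n → SignType} (h : heavyColors c x = ∅)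
    (j : Fin m) : colorCount c 1 j x + colorCount c (-1) j x + 1 ≤ colorCard c j ∧
      2 * colorCount c 1 j x ≤ colorCard c j ∧ 2 * colorCount c (-1) j x ≤ colorCard c j := by
  have h1 : j ∉ heavyColors c x := by simp [h]
  simp only [heavyColors, Finset.mem_filter, Finset.mem_univ, true_and] at h1
  omega

theorem sum_colorCard : ∑ j, colorCard c j = n := by
  have := Finset.card_eq_sum_card_fiberwise (f := c) (s := Finset.univ) (t := Finset.univ)
    (by simp)
  simpa [colorCard] using this.symm

theorem count_ofFn (x : Fin n → SignType) (s : SignType) :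
    (List.ofFn x).count s = (Finset.univ.filter fun i => x i = s).card := by
  rw [← Multiset.coe_count, show ((List.ofFn x : List SignType) :
    Multiset SignType) = (Finset.univ : Finset (Fin n)).val.map x from (Fin.univ_val_map x).symm,
    Multiset.count_map]
  simp [Finset.card, Finset.filter_val, eq_comm]

theorem sum_colorCount (x : Fin n → SignType) (s : SignType) :
    ∑ j, colorCount c s j x = (List.ofFn x).count s := by
  rw [count_ofFn]
  have := Finset.card_eq_sum_card_fiberwise (f := c)
    (s := Finset.univ.filter fun i => x i = s) (t := Finset.univ) (by simp)
  rw [this]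
  refine Finset.sum_congr rfl fun j _ => ?_
  unfold colorCount
  congr 1
  ext i
  simp [and_comm]

theorem countP_ne_zero (l : List SignType) :
    l.countP (· ≠ 0) = l.count 1 + l.count (-1) := by
  induction l with
  | nil => rfl
  | cons a l ih =>
    rw [List.countP_cons, List.count_cons, List.count_cons, ih]
    rcases a with _ | _ | _ <;> simp <;> omega

theorem exists_heavyColors_eq_empty (hr : ∀ j, c (r j) = j) :
    ∃ x : Fin n → SignType, heavyColors c x = ∅ ∧ n ≤ m + signChanges 0 (List.ofFn x) := by
  by_contra! hcon
  have hpos : ∀ j, 0 < colorCard c j := fun j => Finset.card_pos.2 ⟨r j, by simp [hr]⟩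
  have h0 : heavyColors c 0 = ∅ := by
    ext j
    have := hpos j
    have e1 : colorCount c 1 j 0 = 0 := by simp [colorCount]
    have e2 : colorCount c (-1) j 0 = 0 := by simp [colorCount]
    simp [heavyColors, e1, e2]
    omega
  -- The zero vector yields `m < n`, so heavy labels are also at most `n - 1` and the truncated
  -- subtraction is harmless.
  have hn := hcon 0 h0
  have := (isTuckerLabelling_pathLabel c r hr).le (n - 1) (by
    intro x hx
    rcases (heavyColors c x).eq_empty_or_nonempty with h | h
    · rw [pathLabel_of_eq_empty c r h]
      have := hcon x h
      rcases signChanges_ofFn_zero hx with ⟨h1, h2⟩ | ⟨h1, h2⟩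
      · rw [show ((signChanges (-1) (List.ofFn x) : ℤ) - signChanges 1 (List.ofFn x)) = 1 by omega]
        omega
      · rw [show ((signChanges (-1) (List.ofFn x) : ℤ) - signChanges 1 (List.ofFn x)) = -1 by omega]
        omega
    · rw [pathLabel_of_nonempty c r h]
      have h2 := ((heavyColors c x).min' h).isLt
      rcases sign_cast_eq (colorSign_ne_zero c r (hr _) (Finset.min'_mem _ h)) with h3 | h3 <;>
      · rw [h3]
        omega)
  omega

/-- Fair splitting of a colored path, in terms of sign vectors. -/
theorem exists_fair_signs (hc : Function.Surjective c) :
    ∃ x : Fin n → SignType,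
      (∀ i j : Fin n, (i : ℕ) + 1 = j → x i ≠ 0 → x i ≠ x j) ∧
      (∀ j, colorCount c 0 j x = 1) ∧
      (∀ j, 2 * colorCount c 1 j x ≤ colorCard c j ∧
        2 * colorCount c (-1) j x ≤ colorCard c j) ∧
      (Finset.univ.filter fun i => x i = 1).card ≤
        (Finset.univ.filter fun i => x i = -1).card + 1 ∧
      (Finset.univ.filter fun i => x i = -1).card ≤
        (Finset.univ.filter fun i => x i = 1).card + 1 := by
  choose r hr using hc
  obtain ⟨x, h, hx⟩ := exists_heavyColors_eq_empty c r hr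
  have hlt := colorCount_lt_of_heavyColors_eq_empty c h
  have hadd := fun j => colorCount_add c j x
  have hle := signChanges_le 0 (List.ofFn x)
  have hP := countP_ne_zero (List.ofFn x)
  have hS : ∑ j, (colorCount c 1 j x + colorCount c (-1) j x + 1) =
      (List.ofFn x).countP (· ≠ 0) + m := by
    rw [hP, Finset.sum_add_distrib, Finset.sum_add_distrib, sum_colorCount, sum_colorCount]
    simp
  have hS' : ∑ j, (colorCount c 1 j x + colorCount c (-1) j x + 1) ≤ ∑ j, colorCard c j :=
    Finset.sum_le_sum fun j _ => (hlt j).1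
  have hS'' := hS'
  rw [hS, sum_colorCard] at hS''
  -- Here n - m ≤ alt(x) ≤ |supp x| ≤ n - m closes up; equality of the sums then gives equality
  -- color by color.
  have heq : signChanges 0 (List.ofFn x) = (List.ofFn x).countP (· ≠ 0) := by omega
  have hSe : ∑ j, (colorCount c 1 j x + colorCount c (-1) j x + 1) = ∑ j, colorCard c j := by
    rw [hS, sum_colorCard]; omega
  rw [Finset.sum_eq_sum_iff_of_le fun j _ => (hlt j).1] at hSe
  refine ⟨x, ?_, fun j => ?_, fun j => (hlt j).2, ?_, ?_⟩
  · intro i j hij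
    have := (isChain_of_signChanges_eq 0 _ heq).1
    rw [List.isChain_iff_getElem] at this
    have := this i (by simp; omega)
    simp only [List.getElem_ofFn, hij] at this
    exact this
  · have h1 := hSe j (Finset.mem_univ j)
    have h2 := hadd j
    omega
  · rw [← count_ofFn, ← count_ofFn]
    exact (count_of_signChanges_eq _ 0 heq).1 (by decide)
  · rw [← count_ofFn, ← count_ofFn]
    exact (count_of_signChanges_eq _ 0 heq).2.1 (by decide)

end Label

/-! ### Back to the path and its classes -/

theorem half_le_count_of_strict (m : ℕ) (p q : Fin m → Prop) [DecidablePred p] [DecidablePred q]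
    (h : ∀ j, p j ∨ q j) : (m : ℚ) / 2 ≤ ((Finset.univ.filter p).card : ℚ) ∨
      (m : ℚ) / 2 ≤ ((Finset.univ.filter q).card : ℚ) := by
  have h1 : (Finset.univ : Finset (Fin m)) ⊆ Finset.univ.filter p ∪ Finset.univ.filter q := by
    intro j _
    simpa using h j
  have h2 := (Finset.card_le_card h1).trans (Finset.card_union_le _ _)
  rw [Finset.card_univ, Fintype.card_fin] at h2
  have h3 : (m : ℚ) ≤ (Finset.univ.filter p).card + (Finset.univ.filter q).card := by
    exact_mod_cast h2
  by_contra! hcon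
  linarith

theorem theorem1 {V : Type*} [Fintype V] [DecidableEq V] (P : SimpleGraph V) (n : ℕ)
    (hP : Nonempty (P ≃g SimpleGraph.pathGraph n))
    (m : ℕ) (C : Fin m → Finset V)
    (hC_nonempty : ∀ j, (C j).Nonempty)
    (hC_disjoint : ∀ i j, i ≠ j → Disjoint (C i) (C j))
    (hC_cover : ∀ v : V, ∃ j, v ∈ C j) :
    (∃ S : Fin 2 → Finset V,
      (∀ i, P.IsIndepSet (S i : Set V)) ∧
      Disjoint (S 0) (S 1) ∧
      (∀ j, (C j \ (S 0 ∪ S 1)).card = 1) ∧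
      (S 0).card ≤ (S 1).card + 1 ∧
      (S 1).card ≤ (S 0).card + 1 ∧
      ∀ i j, ((C j).card : ℚ) / 2 - 1 ≤ ((S i ∩ C j).card : ℚ)) ∧
    (∃ S : Finset V,
      P.IsIndepSet (S : Set V) ∧
      (∀ j, ((C j).card : ℚ) / 2 - 1 ≤ ((S ∩ C j).card : ℚ)) ∧
      (m : ℚ) / 2 ≤
        ((Finset.univ.filter fun j : Fin m =>
          ((C j).card : ℚ) / 2 - 1 < ((S ∩ C j).card : ℚ)).card : ℚ)) := by
  obtain ⟨e⟩ := hP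
  choose col hcol using hC_cover
  have hmem : ∀ v j, v ∈ C j ↔ col v = j := fun v j =>
    ⟨fun h => by_contra fun hne => Finset.disjoint_left.1 (hC_disjoint _ _ hne) (hcol v) h,
      fun h => h ▸ hcol v⟩
  have hcard : ∀ (p : Fin n → Prop) [DecidablePred p],
      (Finset.univ.filter fun i => p i).card = (Finset.univ.filter fun v => p (e v)).card := by
    intro p _
    refine (Finset.card_bij (fun v _ => e v) (by simp) (fun _ _ _ _ h => e.injective h) ?_).symm
    intro i hi
    exact ⟨e.symm i, by simpa using hi, by simp⟩
  obtain ⟨x, hadj, hzero, hhalf, hp, hq⟩ := exists_fair_signs (fun i => col (e.symm i)) (by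
    intro j
    obtain ⟨v, hv⟩ := hC_nonempty j
    exact ⟨e v, by simpa using (hmem v j).1 hv⟩)
  let T : SignType → Finset V := fun s => Finset.univ.filter fun v => x (e v) = s
  have hTcard : ∀ s, (Finset.univ.filter fun i => x i = s).card = (T s).card := fun s => hcard _
  have hTC : ∀ s j, colorCount (fun i => col (e.symm i)) s j x = (T s ∩ C j).card := by
    intro s j
    unfold colorCount
    rw [hcard]
    congr 1
    ext v
    simp [T, hmem, and_comm]
  have hCC : ∀ j, colorCard (fun i => col (e.symm i)) j = (C j).card := by
    intro j
    unfold colorCard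
    rw [hcard]
    congr 1
    ext v
    simp [hmem]
  have hadd := fun j => colorCount_add (fun i => col (e.symm i)) j x
  simp only [hTC, hCC] at hadd hzero hhalf
  rw [hTcard, hTcard] at hp hq
  have hindep : ∀ s, s ≠ 0 → P.IsIndepSet (T s : Set V) := by
    intro s hs u hu v hv _ huv
    simp only [T, Finset.coe_filter, Finset.mem_univ, true_and, Set.mem_ofPred_eq] at hu hv
    rcases SimpleGraph.pathGraph_adj.1 (e.map_rel_iff.2 huv) with h | h
    · exact hadj _ _ h (by rw [hu]; exact hs) (by rw [hu, hv])
    · exact hadj _ _ h (by rw [hv]; exact hs) (by rw [hu, hv])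
  have hfair : ∀ j, ((C j).card : ℚ) / 2 - 1 ≤ ((T 1 ∩ C j).card : ℚ) ∧
      ((C j).card : ℚ) / 2 - 1 ≤ ((T (-1) ∩ C j).card : ℚ) := by
    intro j
    have h1 := hadd j
    have h2 := hzero j
    have h3 := hhalf j
    have h4 : (C j).card ≤ 2 * (T 1 ∩ C j).card + 2 := by omega
    have h5 : (C j).card ≤ 2 * (T (-1) ∩ C j).card + 2 := by omega
    have h4' : ((C j).card : ℚ) ≤ 2 * (T 1 ∩ C j).card + 2 := by exact_mod_cast h4
    have h5' : ((C j).card : ℚ) ≤ 2 * (T (-1) ∩ C j).card + 2 := by exact_mod_cast h5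
    constructor <;> linarith
  -- The two intersections add up to |V_j| - 1, so they cannot both be at most |V_j|/2 - 1; one of
  -- the two sets is then strict for at least half of the classes.
  have hstrict : ∀ j, ((C j).card : ℚ) / 2 - 1 < ((T 1 ∩ C j).card : ℚ) ∨
      ((C j).card : ℚ) / 2 - 1 < ((T (-1) ∩ C j).card : ℚ) := by
    intro j
    have h1 : (C j).card = (T 1 ∩ C j).card + (T (-1) ∩ C j).card + 1 := by
      have := hadd j
      have := hzero j
      omega
    have h2 : ((C j).card : ℚ) = (T 1 ∩ C j).card + (T (-1) ∩ C j).card + 1 := by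
      exact_mod_cast h1
    by_contra! hcon
    linarith
  refine ⟨⟨![T 1, T (-1)], ?_, ?_, ?_, by simpa using hp, by simpa using hq, ?_⟩, ?_⟩
  · rw [Fin.forall_fin_two]
    exact ⟨hindep 1 (by decide), hindep (-1) (by decide)⟩
  · rw [Finset.disjoint_left]
    intro v hv hv'
    simp only [T, Matrix.cons_val_zero, Matrix.cons_val_one, Finset.mem_filter, Finset.mem_univ,
      true_and] at hv hv'
    rw [hv] at hv'
    exact absurd hv' (by decide)
  · intro j
    refine Eq.trans ?_ (hzero j)
    congr 1
    ext v
    simp only [T, Matrix.cons_val_zero, Matrix.cons_val_one, Finset.mem_sdiff, Finset.mem_union,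
      Finset.mem_inter, Finset.mem_filter, Finset.mem_univ, true_and]
    rcases x (e v) with _ | _ | _ <;> simp
  · rw [Fin.forall_fin_two]
    exact ⟨fun j => (hfair j).1, fun j => (hfair j).2⟩
  · rcases half_le_count_of_strict m _ _ hstrict with h | h
    · exact ⟨T 1, hindep 1 (by decide), fun j => (hfair j).1, h⟩
    · exact ⟨T (-1), hindep (-1) (by decide), fun j => (hfair j).2, h⟩
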